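/- Let $G$ and $H$ be finite simple graphs on the same vertex set $V$. For a vertex $v$ of a graph $G$, the local complementation of $G$ at $v$ is the graph $G*v$ obtained from $G$ by replacing the subgraph induced on the set $N_G(v)$ of neighbors of $v$ by its complement. The graphs $G$ and $H$ are locally equivalent if $H$ can be obtained from $G$ by a finite (possibly empty) sequence of local complementations. A block of a graph is a maximal connected subgraph that itself has no cut-vertices, and a graph is a block graph if each of its blocks is a complete graph. A vertex is simplicial if the set of its neighbors is a clique. If $G$ and $H$ are block graphs, neither of which has a simplicial vertex of degree at least $2$, and $G$ and $H$ are locally equivalent, then $G$ and $H$ are isomorphic. -/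

import Mathlib

namespace SimpleGraph

variable {V : Type*}

/-- The local complementation `G * v`: the adjacency of two distinct vertices is toggled exactly
when both of them are neighbors of `v`. -/
def localComplement (G : SimpleGraph V) (v : V) : SimpleGraph V where
  Adj x y := x ≠ y ∧ Xor (G.Adj x y) (G.Adj v x ∧ G.Adj v y)
  symm := ⟨fun x y h => by
    refine ⟨h.1.symm, ?_⟩
    rw [G.adj_comm y x, and_comm (a := G.Adj v y)]
    exact h.2⟩
  loopless := ⟨fun _ h => h.1 rfl⟩

/-- `H` is obtained from `G` by a finite (possibly empty) sequence of local complementations. -/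
def LocallyEquivalent (G H : SimpleGraph V) : Prop :=
  Relation.ReflTransGen (fun G₁ G₂ => ∃ v, G₂ = G₁.localComplement v) G H

/-- `v` is a cut-vertex: two other vertices in the same component of `G` lie in
different components after `v` is deleted. -/
def IsCutVertex (G : SimpleGraph V) (v : V) : Prop :=
  ∃ x y : ({v}ᶜ : Set V), G.Reachable x y ∧ ¬ (G.induce ({v}ᶜ : Set V)).Reachable x y

/-- A block of `G`: a maximal connected subgraph that has, as a graph on its own, no cut-vertex. -/
def IsBlock (G : SimpleGraph V) (B : G.Subgraph) : Prop :=
  Maximal (fun S : G.Subgraph => S.Connected ∧ ∀ v : S.verts, ¬ S.coe.IsCutVertex v) B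

/-- A block graph: every block is a complete graph. -/
def IsBlockGraph (G : SimpleGraph V) : Prop :=
  ∀ B : G.Subgraph, G.IsBlock B → B.coe = ⊤

/-- A vertex is simplicial if its neighbors form a clique. -/
def IsSimplicial (G : SimpleGraph V) (v : V) : Prop :=
  G.IsClique (G.neighborSet v)

end SimpleGraph

/-!
Both graphs are recovered, up to isomorphism, from which vertex sets `X` have cut-rank `0` or at
most `1`, where the cut-rank of `X` is the rank over `𝔽₂` of the adjacency matrix between `X` and
its complement. These properties are invariant under local complementation
(`LocallyEquivalent.noCrossing_iff`, `LocallyEquivalent.cutRankLeOne_iff`).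

Call two non-isolated vertices kin if the pair they form has cut-rank at most `1`. In a block graph
without simplicial vertices of degree at least `2`, a kinship class is a vertex together with the
leaves attached to it, i.e. a star (`kin_iff`, `exists_kin_center`). Edges between distinct classes
join their centers, and two centers are non-adjacent exactly when they lie in different components
or some third vertex `w` separates them. The latter can be read off from the cut-rank: it amounts to
a set `X` such that both `X` and `X ∪ {w}` have cut-rank at most `1`, with one class inside `X` and
the other outside `X ∪ {w}`, where `w` is non-isolated and in neither class (`adj_center_iff`). If such `X` and `w` existed for adjacent centers,
then `w` would be a leaf attached to one of them or a simplicial vertex of degree at least `2`.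

Hence the permutation that swaps, in each kinship class, the center for `G` with the center for `H`
is an isomorphism from `G` to `H`. The only property of block graphs used is that two neighbors of a
vertex `b` joined by a walk avoiding `b` are adjacent (`IsBlockGraph.adj_of_walk`).
-/

namespace SimpleGraph

variable {V : Type*} {G H : SimpleGraph V}

/-! ### Cycles in block graphs -/

theorem reachable_induce_compl_of_walk {s : Set V} {v : V} {x y : V} (p : G.Walk x y)
    (hs : ∀ z ∈ p.support, z ∈ s) (hv : v ∈ s) (hvp : v ∉ p.support) (hx : x ∈ s) (hy : y ∈ s)
    (hxv : (⟨x, hx⟩ : s) ∈ ({⟨v, hv⟩}ᶜ : Set s)) (hyv : (⟨y, hy⟩ : s) ∈ ({⟨v, hv⟩}ᶜ : Set s)) :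
    (((⊤ : G.Subgraph).induce s).coe.induce ({⟨v, hv⟩}ᶜ : Set s)).Reachable
      ⟨⟨x, hx⟩, hxv⟩ ⟨⟨y, hy⟩, hyv⟩ := by
  induction p with
  | nil => exact Reachable.refl _
  | @cons a b c h q ih =>
    have hb : b ∈ s := hs b (by simp)
    have hbv : b ≠ v := by
      rintro rfl
      exact hvp (by simp)
    have hbv' : (⟨b, hb⟩ : s) ∈ ({⟨v, hv⟩}ᶜ : Set s) := by
      simpa using hbv
    refine Reachable.trans (Adj.reachable ?_)
      (ih (fun z hz => hs z (by simp [hz])) (fun hz => hvp (by simp [hz])) hb hy hbv' hyv)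
    exact ⟨hx, hb, h⟩

theorem reachable_induce_of_walk {s : Set V} {x y : V} (p : G.Walk x y)
    (hs : ∀ z ∈ p.support, z ∈ s) (hx : x ∈ s) (hy : y ∈ s) :
    ((⊤ : G.Subgraph).induce s).coe.Reachable ⟨x, hx⟩ ⟨y, hy⟩ := by
  induction p with
  | nil => exact Reachable.refl _
  | @cons a b c h q ih =>
    have hb : b ∈ s := hs b (by simp)
    refine Reachable.trans (Adj.reachable ?_) (ih (fun z hz => hs z (by simp [hz])) hb hy)
    simp [hx, hb, h]

/-- Two neighbors of `b` that are joined by a walk avoiding `b` lie on a common cycle with `b`,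
hence in a common block. -/
theorem IsBlockGraph.adj_of_walk [Finite V] (hG : G.IsBlockGraph) {a b c : V} (hab : G.Adj a b)
    (hcb : G.Adj c b) (hac : a ≠ c) (q : G.Walk a c) (hq : b ∉ q.support) : G.Adj a c := by
  classical
  obtain ⟨p, hp, hbp⟩ : ∃ p : G.Walk a c, p.IsPath ∧ b ∉ p.support :=
    ⟨q.bypass, q.bypass_isPath, fun h => hq (q.support_bypass_subset_support h)⟩
  let s : Set V := {z | z ∈ p.support ∨ z = b}
  have hbs : b ∈ s := Or.inr rfl
  have key : ∀ y ∈ s, ∀ v, y ≠ v → b ≠ v →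
      ∃ r : G.Walk y b, (∀ z ∈ r.support, z ∈ s) ∧ v ∉ r.support := by
    rintro y (hy | rfl) v hyv hbv
    · -- On a path, a vertex `v ≠ y` cannot occur both before and after `y`.
      by_cases hv : v ∈ (p.takeUntil y hy).support
      · have hv' : v ∉ (p.dropUntil y hy).support := by
          intro hv'
          have hnd := hp.support_nodup
          rw [← p.take_spec hy, Walk.support_append] at hnd
          rw [Walk.mem_support_iff] at hv'
          rcases hv' with h | h
          · exact hyv h.symm
          · exact List.disjoint_of_nodup_append hnd hv h
        refine ⟨(p.dropUntil y hy).concat hcb, fun z hz => ?_, fun hz => ?_⟩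
        · simp only [Walk.support_concat, List.mem_append,
            List.mem_singleton] at hz
          exact hz.imp_left fun h => p.support_dropUntil_subset_support hy h
        · simp only [Walk.support_concat, List.mem_append,
            List.mem_singleton] at hz
          exact hz.elim hv' fun h => hbv h.symm
      · refine ⟨(p.takeUntil y hy).reverse.concat hab, fun z hz => ?_, fun hz => ?_⟩
        · simp only [Walk.support_concat, Walk.support_reverse, List.mem_append,
            List.mem_singleton, List.mem_reverse] at hz
          exact hz.imp_left fun h => p.support_takeUntil_subset_support hy h
        · simp only [Walk.support_concat, Walk.support_reverse, List.mem_append,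
            List.mem_singleton, List.mem_reverse] at hz
          exact hz.elim hv fun h => hbv h.symm
    · exact ⟨Walk.nil, by simpa using hbs, by simpa using hyv.symm⟩
  have hps : ∀ z ∈ p.support, z ∈ s := fun z hz => Or.inl hz
  have has : a ∈ s := hps a (by simp)
  have hcs : c ∈ s := hps c (by simp)
  let S : G.Subgraph := (⊤ : G.Subgraph).induce s
  have hS : S.Connected ∧ ∀ v : S.verts, ¬ S.coe.IsCutVertex v := by
    constructor
    · have hto : ∀ y : s, S.coe.Reachable y ⟨b, hbs⟩ := by
        rintro ⟨y, hy⟩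
        by_cases hyb : y = b
        · subst hyb
          exact Reachable.refl _
        rcases hy with hy | hy
        · refine (reachable_induce_of_walk (p.takeUntil y hy).reverse (fun z hz => ?_) _ has).trans
            (Adj.reachable ?_)
          · rw [Walk.support_reverse, List.mem_reverse] at hz
            exact hps z (p.support_takeUntil_subset_support hy hz)
          · simp [has, hbs, hab]
        · exact absurd hy hyb
      have : Nonempty S.verts := ⟨⟨b, hbs⟩⟩
      exact Subgraph.connected_iff'.2 ⟨fun x y => (hto x).trans (hto y).symm⟩
    · rintro ⟨v, hv⟩ ⟨⟨⟨x, hx⟩, hxv⟩, ⟨⟨y, hy⟩, hyv⟩, -, hnr⟩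
      have hxv' : x ≠ v := fun h => hxv (Subtype.ext h)
      have hyv' : y ≠ v := fun h => hyv (Subtype.ext h)
      by_cases hbv : b = v
      · subst hbv
        have hx' : x ∈ p.support := hx.resolve_right hxv'
        have hy' : y ∈ p.support := hy.resolve_right hyv'
        refine hnr (reachable_induce_compl_of_walk
          ((p.takeUntil x hx').reverse.append (p.takeUntil y hy')) ?_ hv ?_ hx hy hxv hyv)
        · intro z hz
          rw [Walk.mem_support_append_iff, Walk.support_reverse, List.mem_reverse] at hz
          exact hz.elim (fun h => hps z (p.support_takeUntil_subset_support hx' h))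
            fun h => hps z (p.support_takeUntil_subset_support hy' h)
        · intro hz
          rw [Walk.mem_support_append_iff, Walk.support_reverse, List.mem_reverse] at hz
          exact hbp (hz.elim (fun h => p.support_takeUntil_subset_support hx' h)
            fun h => p.support_takeUntil_subset_support hy' h)
      · have hbv' : (⟨b, hbs⟩ : s) ∈ ({⟨v, hv⟩}ᶜ : Set s) := fun h => hbv (congrArg Subtype.val h)
        obtain ⟨r, hr, hvr⟩ := key x hx v hxv' hbv
        obtain ⟨t, ht, hvt⟩ := key y hy v hyv' hbv
        exact hnr ((reachable_induce_compl_of_walk r hr hv hvr hx hbs hxv hbv').trans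
          (reachable_induce_compl_of_walk t ht hv hvt hy hbs hyv hbv').symm)
  obtain ⟨B, hSB, hB⟩ := (Set.toFinite {S : G.Subgraph | S.Connected ∧
    ∀ v : S.verts, ¬ S.coe.IsCutVertex v}).exists_le_maximal hS
  have hBtop := hG B hB
  have : B.coe.Adj ⟨a, hSB.1 has⟩ ⟨c, hSB.1 hcs⟩ := by
    rw [hBtop]
    exact fun h => hac (congrArg Subtype.val h)
  exact B.adj_sub this

theorem IsBlockGraph.adj_of_four_cycle [Finite V] (hG : G.IsBlockGraph) {a b c d : V}
    (hab : G.Adj a b) (hbc : G.Adj b c) (hcd : G.Adj c d) (hda : G.Adj d a)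
    (hac : a ≠ c) (hbd : b ≠ d) : G.Adj a c :=
  hG.adj_of_walk hab hbc.symm hac (.cons hda.symm (.cons hcd.symm .nil))
    (by simp [hab.ne', hbd, hbc.ne])

/-- In a block graph, two non-adjacent vertices of a component are separated by a single vertex,
namely the second vertex `w` of a shortest path. -/
theorem IsBlockGraph.exists_separating [Finite V] (hG : G.IsBlockGraph) {u v : V}
    (huv : G.Reachable u v) (hne : u ≠ v) (hadj : ¬ G.Adj u v) :
    ∃ w x, G.Adj u w ∧ G.Adj w x ∧ x ≠ u ∧ w ≠ v ∧ ∀ p : G.Walk u v, w ∈ p.support := by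
  obtain ⟨p, hp, hlen⟩ := huv.exists_path_of_dist
  cases p with
  | nil => exact absurd rfl hne
  | @cons _ w _ h p' =>
    cases p' with
    | nil => exact absurd h hadj
    | @cons _ x _ h' q =>
      simp only [Walk.cons_isPath_iff, Walk.support_cons, List.mem_cons, not_or] at hp
      obtain ⟨⟨-, hwq⟩, huw, huq⟩ := hp
      refine ⟨w, x, h, h', ?_, ?_, fun r => ?_⟩
      · rintro rfl
        exact huq (by simp)
      · rintro rfl
        exact hwq (by simp)
      · by_contra hr
        have hux : u ≠ x := by
          rintro rfl
          exact huq (by simp)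
        have hadj' : G.Adj u x := hG.adj_of_walk h h'.symm hux (r.append q.reverse) (by
          rw [Walk.mem_support_append_iff, Walk.support_reverse, List.mem_reverse]
          exact not_or.mpr ⟨hr, hwq⟩)
        have := dist_le (Walk.cons hadj' q)
        simp only [Walk.length_cons] at this hlen
        omega

/-! ### Sets of small cut-rank -/

/-- No edge leaves `X`, i.e. the cut-rank of `X` is `0`. -/
def NoCrossing (G : SimpleGraph V) (X : Set V) : Prop :=
  ∀ x ∈ X, ∀ y ∉ X, ¬ G.Adj x y

/-- The cut-rank of `X` is at most `1`. A matrix over `𝔽₂` has rank at most `1` exactly when it is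
an outer product, so this says that the edges leaving `X` form a complete bipartite graph. -/
def CutRankLeOne (G : SimpleGraph V) (X : Set V) : Prop :=
  ∃ P Q : Set V, ∀ x ∈ X, ∀ y ∉ X, (G.Adj x y ↔ x ∈ P ∧ y ∈ Q)

theorem localComplement_localComplement (G : SimpleGraph V) (v : V) :
    (G.localComplement v).localComplement v = G := by
  ext x y
  have := G.ne_of_adj (a := x) (b := y)
  have := G.ne_of_adj (a := v) (b := x)
  have := G.ne_of_adj (a := v) (b := y)
  have := G.irrefl (v := v)
  simp only [localComplement, Xor]
  tauto

theorem LocallyEquivalent.symm (h : G.LocallyEquivalent H) : H.LocallyEquivalent G := by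
  unfold LocallyEquivalent at h ⊢
  induction h with
  | refl => exact .refl
  | tail _ h ih =>
    obtain ⟨v, rfl⟩ := h
    exact .head ⟨v, (localComplement_localComplement _ v).symm⟩ ih

theorem NoCrossing.localComplement {X : Set V} (h : G.NoCrossing X) (v : V) :
    (G.localComplement v).NoCrossing X := by
  intro x hx y hy hxy
  rcases hxy.2 with h' | h'
  · exact h x hx y hy h'.1
  · by_cases hv : v ∈ X
    · exact h v hv y hy h'.1.2
    · exact h x hx v hv h'.1.1.symm

theorem CutRankLeOne.localComplement {X : Set V} (h : G.CutRankLeOne X) (v : V) :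
    (G.localComplement v).CutRankLeOne X := by
  obtain ⟨P, Q, h⟩ := h
  -- Complementing at `v ∈ X` adds the row of `v` to the rows of the neighbors of `v`.
  by_cases hv : v ∈ X
  · refine ⟨{x | Xor (x ∈ P) (G.Adj v x ∧ v ∈ P)}, Q, fun x hx y hy => ?_⟩
    have hne : x ≠ y := fun e => hy (e ▸ hx)
    have h1 := h x hx y hy
    have h2 := h v hv y hy
    simp only [SimpleGraph.localComplement, Xor, Set.mem_ofPred_eq]
    tauto
  · refine ⟨P, {y | Xor (y ∈ Q) (G.Adj v y ∧ v ∈ Q)}, fun x hx y hy => ?_⟩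
    have hne : x ≠ y := fun e => hy (e ▸ hx)
    have h1 := h x hx y hy
    have h2 := h x hx v hv
    rw [G.adj_comm] at h2
    simp only [SimpleGraph.localComplement, Xor, Set.mem_ofPred_eq]
    tauto

theorem LocallyEquivalent.noCrossing_iff (h : G.LocallyEquivalent H) (X : Set V) :
    G.NoCrossing X ↔ H.NoCrossing X := by
  have key : ∀ {G H : SimpleGraph V}, G.LocallyEquivalent H → G.NoCrossing X → H.NoCrossing X := by
    intro G H h hX
    unfold LocallyEquivalent at h
    induction h with
    | refl => exact hX
    | tail _ h ih =>
      obtain ⟨v, rfl⟩ := h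
      exact ih.localComplement v
  exact ⟨key h, key h.symm⟩

theorem LocallyEquivalent.cutRankLeOne_iff (h : G.LocallyEquivalent H) (X : Set V) :
    G.CutRankLeOne X ↔ H.CutRankLeOne X := by
  have key : ∀ {G H : SimpleGraph V}, G.LocallyEquivalent H →
      G.CutRankLeOne X → H.CutRankLeOne X := by
    intro G H h hX
    unfold LocallyEquivalent at h
    induction h with
    | refl => exact hX
    | tail _ h ih =>
      obtain ⟨v, rfl⟩ := h
      exact ih.localComplement v
  exact ⟨key h, key h.symm⟩

theorem CutRankLeOne.adj_of_adj_of_adj {X : Set V} (h : G.CutRankLeOne X) {p q p' q' : V}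
    (hp : p ∈ X) (hq : q ∉ X) (hp' : p' ∈ X) (hq' : q' ∉ X) (hpq : G.Adj p q)
    (hpq' : G.Adj p' q') : G.Adj p q' := by
  obtain ⟨P, Q, h⟩ := h
  exact (h p hp q' hq').2 ⟨((h p hp q hq).1 hpq).1, ((h p' hp' q' hq').1 hpq').2⟩

theorem not_noCrossing_singleton {x : V} : ¬ G.NoCrossing {x} ↔ ∃ y, G.Adj x y := by
  refine ⟨fun h => ?_, fun ⟨y, hy⟩ h => h x rfl y hy.ne' hy⟩
  by_contra! h'
  exact h fun z hz y _ => hz ▸ h' y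

/-! ### Kinship classes -/

/-- Two vertices are kin if they are equal, or if both are non-isolated and the pair they form has
cut-rank at most `1`. Non-isolation is phrased by `NoCrossing`, which makes the invariance under
local equivalence evident; without it an isolated vertex would be kin to every vertex. -/
def Kin (G : SimpleGraph V) (x y : V) : Prop :=
  x = y ∨ ¬ G.NoCrossing {x} ∧ ¬ G.NoCrossing {y} ∧ G.CutRankLeOne {x, y}

/-- The kinship classes of `x` and `y` lie on different sides of a cut of rank `0`, or are strictly
separated by a non-isolated vertex `w`, in the sense that `w` can be placed on either side of a cut
between them without the cut-rank exceeding `1`. -/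
def KinSeparated (G : SimpleGraph V) (x y : V) : Prop :=
  ∃ X : Set V, (∀ z, G.Kin z x → z ∈ X) ∧ (∀ z, G.Kin z y → z ∉ X) ∧
    (G.NoCrossing X ∨ ∃ w ∉ X, ¬ G.Kin w x ∧ ¬ G.Kin w y ∧ ¬ G.NoCrossing {w} ∧
      G.CutRankLeOne X ∧ G.CutRankLeOne (insert w X))

theorem LocallyEquivalent.kin_iff (h : G.LocallyEquivalent H) (x y : V) :
    G.Kin x y ↔ H.Kin x y := by
  simp only [Kin, h.noCrossing_iff, h.cutRankLeOne_iff]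

theorem LocallyEquivalent.kinSeparated_iff (h : G.LocallyEquivalent H) (x y : V) :
    G.KinSeparated x y ↔ H.KinSeparated x y := by
  simp only [KinSeparated, h.noCrossing_iff, h.cutRankLeOne_iff, h.kin_iff]

/-- A block graph without simplicial vertices of degree at least `2`. -/
structure IsReducedBlockGraph (G : SimpleGraph V) : Prop where
  isBlockGraph : G.IsBlockGraph
  not_simplicial : ¬ ∃ v : V, G.IsSimplicial v ∧ 2 ≤ (G.neighborSet v).ncard

theorem IsReducedBlockGraph.false_of_simplicial [Finite V] (hG : G.IsReducedBlockGraph)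
    {w a b : V} (ha : G.Adj w a) (hb : G.Adj w b) (hab : a ≠ b)
    (h : ∀ n m, G.Adj w n → G.Adj w m → n ≠ m → G.Adj n m) : False :=
  hG.not_simplicial ⟨w, fun n hn m hm => h n m hn hm,
    (Set.one_lt_ncard_iff (Set.toFinite _)).2 ⟨a, b, ha, hb, hab⟩⟩

/-- `l` is a leaf attached to `c`. -/
def IsLeafOf (G : SimpleGraph V) (l c : V) : Prop :=
  ∀ z, G.Adj l z ↔ z = c

theorem IsLeafOf.unique {l c d : V} (h : G.IsLeafOf l c) (h' : G.IsLeafOf l d) : c = d :=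
  (h' c).1 ((h c).2 rfl)

theorem IsLeafOf.eq_of_isLeafOf {l c d : V} (h : G.IsLeafOf l c) (h' : G.IsLeafOf c d) : l = d :=
  (h' l).1 ((h c).2 rfl).symm

/-- In a reduced block graph, distinct kin are a leaf and its neighbor, or two leaves with the same
neighbor. Indeed non-adjacent twins with two common neighbors would lie on a 4-cycle without chords,
and adjacent twins of degree at least `2` would be simplicial. -/
theorem IsReducedBlockGraph.kin_iff [Finite V] (hG : G.IsReducedBlockGraph) {x y : V} :
    G.Kin x y ↔ x = y ∨ G.IsLeafOf x y ∨ G.IsLeafOf y x ∨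
      ∃ c, G.IsLeafOf x c ∧ G.IsLeafOf y c := by
  unfold Kin
  rw [not_noCrossing_singleton, not_noCrossing_singleton]
  constructor
  · rintro (h | ⟨⟨x', hx⟩, ⟨y', hy⟩, P, Q, h⟩)
    · exact .inl h
    by_cases hxy : x = y
    · exact .inl hxy
    right
    by_cases hx1 : ∀ z, G.Adj x z → z = y
    · exact .inl fun z => ⟨hx1 z, fun e => by rw [e, ← hx1 x' hx]; exact hx⟩
    by_cases hy1 : ∀ z, G.Adj y z → z = x
    · exact .inr (.inl fun z => ⟨hy1 z, fun e => by rw [e, ← hy1 y' hy]; exact hy⟩)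
    push Not at hx1 hy1
    obtain ⟨p, hxp, hpy⟩ := hx1
    obtain ⟨q, hyq, hqx⟩ := hy1
    have tw : ∀ z, z ≠ x → z ≠ y → (G.Adj x z ↔ G.Adj y z) := by
      have h1 := (h x (by simp) p (by simp [hxp.ne', hpy])).1 hxp
      have h2 := (h y (by simp) q (by simp [hyq.ne', hqx])).1 hyq
      intro z hzx hzy
      rw [h x (by simp) z (by simp [hzx, hzy]), h y (by simp) z (by simp [hzx, hzy])]
      exact and_congr_left fun _ => iff_of_true h1.1 h2.1
    have hyp : G.Adj y p := (tw p hxp.ne' hpy).1 hxp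
    -- Any two common neighbors close a 4-cycle with `x` and `y`.
    have four : ∀ n m, n ≠ m → n ≠ y → m ≠ y → G.Adj x n → G.Adj x m →
        G.Adj n m ∧ G.Adj x y := by
      intro n m hnm hny hmy hn hm
      have hn' := (tw n hn.ne' hny).1 hn
      have hm' := (tw m hm.ne' hmy).1 hm
      exact ⟨hG.isBlockGraph.adj_of_four_cycle hn.symm hm hm'.symm hn' hnm hxy,
        hG.isBlockGraph.adj_of_four_cycle hn hn'.symm hm' hm.symm hxy hnm⟩
    by_cases hadj : G.Adj x y
    · refine (hG.false_of_simplicial hadj hxp (Ne.symm hpy) fun n m hn hm hnm => ?_).elim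
      by_cases hny : n = y
      · subst hny
        exact (tw m hm.ne' (Ne.symm hnm)).1 hm
      by_cases hmy : m = y
      · subst hmy
        exact ((tw n hn.ne' hnm).1 hn).symm
      exact (four n m hnm hny hmy hn hm).1
    · have huniq : ∀ z, G.Adj x z → z = p := by
        intro z hz
        by_contra hne
        exact hadj (four z p hne (fun e => hadj (e ▸ hz)) hpy hz hxp).2
      refine .inr (.inr ⟨p, fun z => ⟨huniq z, fun e => e ▸ hxp⟩, fun z => ⟨fun hz => ?_,
        fun e => e ▸ hyp⟩⟩)
      have hzx : z ≠ x := fun e => hadj (e ▸ hz).symm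
      exact huniq z ((tw z hzx hz.ne').2 hz)
  · rintro (h | h | h | ⟨c, h, h'⟩)
    · exact .inl h
    · have hxy := (h y).2 rfl
      refine .inr ⟨⟨y, hxy⟩, ⟨x, hxy.symm⟩, {y}, {z | G.Adj y z}, fun a ha b hb => ?_⟩
      simp only [Set.mem_insert_iff, Set.mem_singleton_iff, not_or] at ha hb
      rcases ha with rfl | rfl
      · simp [h b, hb.2, hxy.ne]
      · simp
    · have hyx := (h x).2 rfl
      refine .inr ⟨⟨y, hyx.symm⟩, ⟨x, hyx⟩, {x}, {z | G.Adj x z}, fun a ha b hb => ?_⟩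
      simp only [Set.mem_insert_iff, Set.mem_singleton_iff, not_or] at ha hb
      rcases ha with rfl | rfl
      · simp
      · simp [h b, hb.1, hyx.ne]
    · refine .inr ⟨⟨c, (h c).2 rfl⟩, ⟨c, (h' c).2 rfl⟩, Set.univ, {c}, fun a ha b hb => ?_⟩
      rcases ha with rfl | rfl
      · simp [h b]
      · simp [h' b]

theorem IsReducedBlockGraph.kin_equivalence [Finite V] (hG : G.IsReducedBlockGraph) :
    Equivalence G.Kin where
  refl x := .inl rfl
  symm {x y} h := by
    rw [hG.kin_iff] at h ⊢
    rcases h with h | h | h | ⟨c, h, h'⟩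
    · exact .inl h.symm
    · exact .inr (.inr (.inl h))
    · exact .inr (.inl h)
    · exact .inr (.inr (.inr ⟨c, h', h⟩))
  trans {x y z} h h' := by
    rw [hG.kin_iff] at h h' ⊢
    grind [IsLeafOf.unique, IsLeafOf.eq_of_isLeafOf]

/-- Every kinship class has a center to which all its other members are attached as leaves. The
center of the class of `x` is chosen as a function of `x` that is constant on classes. In a
component with two vertices, either one can be the center. -/
theorem IsReducedBlockGraph.exists_kin_center [Finite V] (hG : G.IsReducedBlockGraph) :
    ∃ c : V → V, (∀ x, G.Kin (c x) x) ∧ (∀ x y, G.Kin x y → c x = c y) ∧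
      ∀ x, x ≠ c x → G.IsLeafOf x (c x) := by
  have hE := hG.kin_equivalence
  let s : Setoid V := ⟨G.Kin, hE⟩
  have of_leaf : ∀ l c, G.IsLeafOf l c →
      ∀ y, G.Kin y l → y ≠ c → G.IsLeafOf y c := by
    intro l c hl y hy hyc
    rw [hG.kin_iff] at hy
    rcases hy with rfl | h | h | ⟨d, h, h'⟩
    · exact hl
    · exact absurd (h.eq_of_isLeafOf hl) hyc
    · exact absurd (h.unique hl) hyc
    · exact h'.unique hl ▸ h
  have key : ∀ q : Quotient s, ∃ c, (⟦c⟧ : Quotient s) = q ∧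
      ∀ y, (⟦y⟧ : Quotient s) = q → y ≠ c → G.IsLeafOf y c := by
    intro q
    induction q using Quotient.inductionOn with
    | h x =>
    have conv : ∀ l c, G.Kin l x → G.IsLeafOf l c →
        ∃ c, (⟦c⟧ : Quotient s) = ⟦x⟧ ∧
          ∀ y, (⟦y⟧ : Quotient s) = ⟦x⟧ → y ≠ c → G.IsLeafOf y c := by
      intro l c hlx hl
      refine ⟨c, Quotient.sound (hE.trans (hG.kin_iff.2 (.inr (.inr (.inl hl)))) hlx),
        fun y hy => of_leaf l c hl y (hE.trans (Quotient.exact hy) (hE.symm hlx))⟩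
    by_cases hsing : ∀ y, G.Kin y x → y = x
    · exact ⟨x, rfl, fun y hy hyx => absurd (hsing y (Quotient.exact hy)) hyx⟩
    push Not at hsing
    obtain ⟨y, hyx, hne⟩ := hsing
    rcases hG.kin_iff.1 hyx with h | h | h | ⟨d, h, h'⟩
    · exact absurd h hne
    · exact conv y x hyx h
    · exact conv x y (hE.refl x) h
    · exact conv x d (hE.refl x) h'
  choose c hc hc' using key
  exact ⟨fun x => c ⟦x⟧, fun x => Quotient.exact (hc ⟦x⟧),
    fun x y h => congrArg c (Quotient.sound h), fun x hx => hc' ⟦x⟧ x rfl hx⟩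

/-! ### Adjacency between kinship classes -/

/-- If `X` and `X ∪ {w}` have cut-rank at most `1` and `ab` is an edge with `a ∈ X`, `b ∉ X ∪ {w}`,
then every neighbor of `w` inside `X` is adjacent to `b` and every one outside `X` is adjacent to `a`.
Since 4-cycles have chords, `w` is then isolated, a leaf attached to `a` or `b`, or simplicial of
degree at least `2`. -/
theorem IsReducedBlockGraph.leaf_of_cutRankLeOne [Finite V] (hG : G.IsReducedBlockGraph)
    {X : Set V} {a b w : V} (ha : a ∈ X) (hb : b ∉ X) (hw : w ∉ X) (hbw : b ≠ w)
    (hab : G.Adj a b) (hX : G.CutRankLeOne X) (hwX : G.CutRankLeOne (insert w X))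
    (hiso : ∃ z, G.Adj w z) : G.IsLeafOf w a ∨ G.IsLeafOf w b := by
  have haw : a ≠ w := fun e => hw (e ▸ ha)
  have hbi : b ∉ insert w X := by simp [hb, hbw]
  have inside : ∀ x ∈ X, G.Adj w x → G.Adj a w ∧ G.Adj x b := fun x hx hwx =>
    ⟨hX.adj_of_adj_of_adj ha hb hx hw hab hwx.symm, hX.adj_of_adj_of_adj hx hw ha hb hwx.symm hab⟩
  have outside : ∀ y ∉ X, G.Adj w y → G.Adj w b ∧ G.Adj a y := fun y hy hwy =>
    have hyi : y ∉ insert w X := by simp [hy, hwy.ne']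
    ⟨hwX.adj_of_adj_of_adj (by simp) hyi (by simp [ha]) hbi hwy hab,
      hwX.adj_of_adj_of_adj (by simp [ha]) hbi (by simp) hyi hab hwy⟩
  by_cases hwa : G.Adj w a
  · by_cases hwb : G.Adj w b
    · have toA : ∀ n, G.Adj w n → n ≠ a → G.Adj n a := by
        intro n hn hna
        by_cases hnX : n ∈ X
        · exact hG.isBlockGraph.adj_of_four_cycle (inside n hnX hn).2 hab.symm hwa.symm hn hna hbw
        · exact (outside n hnX hn).2.symm
      refine (hG.false_of_simplicial hwa hwb hab.ne fun n m hn hm hnm => ?_).elim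
      by_cases hna : n = a
      · subst hna
        exact (toA m hm (Ne.symm hnm)).symm
      by_cases hma : m = a
      · subst hma
        exact toA n hn hnm
      exact hG.isBlockGraph.adj_of_four_cycle (toA n hn hna) (toA m hm hma).symm hm.symm hn hnm haw
    · refine .inl fun z => ⟨fun hz => ?_, fun e => e ▸ hwa⟩
      by_cases hzX : z ∈ X
      · by_contra hza
        exact hwb (hG.isBlockGraph.adj_of_four_cycle hz (inside z hzX hz).2 hab.symm hwa.symm
          hbw.symm hza)
      · exact absurd (outside z hzX hz).1 hwb
  · have hout : ∀ z, G.Adj w z → z ∉ X := fun z hz hzX => hwa (inside z hzX hz).1.symm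
    obtain ⟨z₀, hz₀⟩ := hiso
    have hwb := (outside z₀ (hout z₀ hz₀) hz₀).1
    refine .inr fun z => ⟨fun hz => ?_, fun e => e ▸ hwb⟩
    by_contra hzb
    exact hwa (hG.isBlockGraph.adj_of_four_cycle hz (outside z (hout z hz) hz).2.symm hab
      hwb.symm haw.symm hzb)

/-- Adjacency of the centers of two kinship classes depends only on the cut-rank function. -/
theorem IsReducedBlockGraph.adj_center_iff [Finite V] (hG : G.IsReducedBlockGraph) {c : V → V}
    (hc : ∀ x, G.Kin (c x) x) (hc' : ∀ x y, G.Kin x y → c x = c y)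
    (hleaf : ∀ x, x ≠ c x → G.IsLeafOf x (c x)) {x y : V} (hxy : ¬ G.Kin x y) :
    G.Adj (c x) (c y) ↔ ¬ G.KinSeparated x y := by
  have hE := hG.kin_equivalence
  constructor
  · rintro hadj ⟨X, hxX, hyX, h | ⟨w, hw, hwx, hwy, hiso, h1, h2⟩⟩
    · exact h _ (hxX _ (hc x)) _ (hyX _ (hc y)) hadj
    · have hyw : c y ≠ w := by
        rintro rfl
        exact hwy (hc y)
      rcases hG.leaf_of_cutRankLeOne (hxX _ (hc x)) (hyX _ (hc y)) hw hyw hadj h1 h2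
        (not_noCrossing_singleton.1 hiso) with h | h
      · exact hwx (hE.trans (hG.kin_iff.2 (.inr (.inl h))) (hc x))
      · exact hwy (hE.trans (hG.kin_iff.2 (.inr (.inl h))) (hc y))
  · contrapose!
    intro hadj
    have hne : c x ≠ c y := fun e => hxy (hE.trans (hE.symm (hc x)) (e ▸ hc y))
    -- Members of a class other than the center `c x` are leaves attached to it.
    have mem : ∀ z x, G.Kin z x → z = c x ∨ G.IsLeafOf z (c x) := by
      intro z x hz
      have := hleaf z
      rw [hc' z x hz] at this
      by_cases h : z = c x
      · exact .inl h
      · exact .inr (this h)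
    by_cases hr : G.Reachable (c x) (c y)
    · obtain ⟨w, t, huw, hwt, htu, hwv, hsep⟩ := hG.isBlockGraph.exists_separating hr hne hadj
      have hwx : ¬ G.Kin w x := by
        intro h
        rcases mem w x h with h | h
        · exact huw.ne h.symm
        · exact htu ((h t).1 hwt)
      have hwy : ¬ G.Kin w y := by
        intro h
        rcases mem w y h with h | h
        · exact hwv h
        · exact hne ((h _).1 huw.symm)
      let X : Set V := {z | ∃ p : G.Walk (c x) z, w ∉ p.support}
      have hX : ∀ p ∈ X, ∀ q, q ≠ w → G.Adj p q → q ∈ X := by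
        rintro p ⟨r, hr⟩ q hqw hpq
        refine ⟨r.concat hpq, ?_⟩
        rw [Walk.support_concat, List.mem_append, List.mem_singleton]
        exact not_or.mpr ⟨hr, Ne.symm hqw⟩
      have hcX : c x ∈ X := ⟨Walk.nil, by simpa using huw.ne'⟩
      have hcy : c y ∉ X := fun ⟨p, hp⟩ => hp (hsep p)
      refine ⟨X, fun z hz => ?_, fun z hz hzX => ?_, .inr ⟨w, fun ⟨p, hp⟩ => hp (by simp), hwx, hwy,
        not_noCrossing_singleton.2 ⟨_, huw.symm⟩, ⟨{z | G.Adj z w}, {w}, fun p hp q hq => ?_⟩,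
        ⟨{w}, {z | G.Adj w z}, fun p hp q hq => ?_⟩⟩⟩
      · rcases mem z x hz with rfl | h
        · exact hcX
        · exact hX _ hcX z (fun e => hwx (e ▸ hz)) ((h _).2 rfl).symm
      · rcases mem z y hz with rfl | h
        · exact hcy hzX
        · exact hcy (hX z hzX _ (Ne.symm hwv) ((h _).2 rfl))
      · -- Every edge leaving `X` ends in `w`.
        simp only [Set.mem_ofPred_eq, Set.mem_singleton_iff]
        refine ⟨fun h => ?_, fun ⟨h, e⟩ => e ▸ h⟩
        have : q = w := by
          by_contra hqw
          exact hq (hX p hp q hqw h)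
        exact ⟨this ▸ h, this⟩
      · simp only [Set.mem_ofPred_eq, Set.mem_singleton_iff]
        refine ⟨fun h => ?_, fun ⟨e, h⟩ => e ▸ h⟩
        have : p = w := by
          by_contra hpw
          exact hq (.inr (hX p (hp.resolve_left hpw) q (fun e => hq (.inl e)) h))
        exact ⟨this, this ▸ h⟩
    · refine ⟨{z | G.Reachable (c x) z}, fun z hz => ?_, fun z hz hzX => ?_,
        .inl fun p hp q hq h => hq (Reachable.trans hp h.reachable)⟩
      · rcases mem z x hz with rfl | h
        · exact Reachable.refl _
        · exact ((h _).2 rfl).symm.reachable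
      · rcases mem z y hz with rfl | h
        · exact hr hzX
        · exact hr (Reachable.trans hzX ((h _).2 rfl).reachable)

/-- A reduced block graph is described by its kinship classes, their centers and the separation
relation between classes. -/
theorem IsReducedBlockGraph.adj_iff [Finite V] (hG : G.IsReducedBlockGraph) {c : V → V}
    (hc : ∀ x, G.Kin (c x) x) (hc' : ∀ x y, G.Kin x y → c x = c y)
    (hleaf : ∀ x, x ≠ c x → G.IsLeafOf x (c x)) (x y : V) :
    G.Adj x y ↔ x ≠ y ∧ (x = c x ∨ y = c y) ∧
      (¬ G.Kin x y → x = c x ∧ y = c y ∧ ¬ G.KinSeparated x y) := by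
  have hE := hG.kin_equivalence
  by_cases hxy : G.Kin x y
  · have hcxy := hc' x y hxy
    have h1 : x ≠ c x → ∀ z, G.Adj x z ↔ z = c x := hleaf x
    have h2 : y ≠ c y → ∀ z, G.Adj y z ↔ z = c y := hleaf y
    have h3 := G.adj_comm x y
    have h4 := G.ne_of_adj (a := x) (b := y)
    grind
  · have hne : x ≠ y := fun e => hxy (e ▸ hE.refl x)
    have h1 : G.Adj x y → x = c x := by
      intro h
      by_contra hx
      rw [hleaf x hx] at h
      exact hxy (h ▸ hE.symm (hc x))
    have h2 : G.Adj x y → y = c y := by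
      intro h
      by_contra hy
      rw [G.adj_comm, hleaf y hy] at h
      exact hxy (h ▸ hc y)
    have h3 := hG.adj_center_iff hc hc' hleaf hxy
    grind

end SimpleGraph

open SimpleGraph in
theorem theorem1p4 {V : Type*} [Finite V] (G H : SimpleGraph V)
    (hG : G.IsBlockGraph) (hH : H.IsBlockGraph)
    (hGs : ¬ ∃ v : V, G.IsSimplicial v ∧ 2 ≤ (G.neighborSet v).ncard)
    (hHs : ¬ ∃ v : V, H.IsSimplicial v ∧ 2 ≤ (H.neighborSet v).ncard)
    (hGH : G.LocallyEquivalent H) :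
    Nonempty (G ≃g H) := by
  classical
  have rG : G.IsReducedBlockGraph := ⟨hG, hGs⟩
  have rH : H.IsReducedBlockGraph := ⟨hH, hHs⟩
  have hE := rH.kin_equivalence
  obtain ⟨c, hc, hc', hcl⟩ := rG.exists_kin_center
  obtain ⟨d, hd, hd', hdl⟩ := rH.exists_kin_center
  have adjG := rG.adj_iff hc hc' hcl
  have adjH := rH.adj_iff hd hd' hdl
  simp only [hGH.kin_iff, hGH.kinSeparated_iff] at hc hc' adjG
  -- `c` and `d` are constant on kinship classes, so `f` acts on each class as one transposition.
  let f : V → V := fun x => Equiv.swap (c x) (d x) x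
  have hf : ∀ x, H.Kin (f x) x := by
    intro x
    rcases eq_or_ne x (c x) with h | h
    · have : f x = d x := by
        change Equiv.swap (c x) (d x) x = d x
        rw [← h, Equiv.swap_apply_left]
      rw [this]
      exact hd x
    · rcases eq_or_ne x (d x) with h' | h'
      · have : f x = c x := by
          change Equiv.swap (c x) (d x) x = c x
          rw [← h', Equiv.swap_apply_right]
        rw [this]
        exact hc x
      · have : f x = x := Equiv.swap_apply_of_ne_of_ne h h'
        rw [this]
        exact hE.refl x
  have hinv : Function.Involutive f := by
    intro x
    change Equiv.swap (c (f x)) (d (f x)) (Equiv.swap (c x) (d x) x) = x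
    rw [hc' _ _ (hf x), hd' _ _ (hf x), Equiv.swap_apply_self]
  have hcenter : ∀ x, f x = d (f x) ↔ x = c x := by
    intro x
    rw [hd' _ _ (hf x)]
    change Equiv.swap (c x) (d x) x = d x ↔ x = c x
    rw [Equiv.swap_apply_eq_iff, Equiv.swap_apply_right]
  have hkin : ∀ x y, H.Kin (f x) (f y) ↔ H.Kin x y := fun x y =>
    ⟨fun h => hE.trans (hE.symm (hf x)) (hE.trans h (hf y)),
      fun h => hE.trans (hf x) (hE.trans h (hE.symm (hf y)))⟩
  have hcongr : ∀ x z, H.Kin z (f x) ↔ H.Kin z x := fun x z =>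
    ⟨fun h => hE.trans h (hf x), fun h => hE.trans h (hE.symm (hf x))⟩
  have hsep : ∀ x y, H.KinSeparated (f x) (f y) ↔ H.KinSeparated x y := by
    intro x y
    simp only [KinSeparated, hcongr]
  refine ⟨⟨hinv.toPerm f, fun {x y} => ?_⟩⟩
  change H.Adj (f x) (f y) ↔ G.Adj x y
  rw [adjG, adjH, hcenter, hcenter, hkin, hsep, hinv.injective.ne_iff]
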